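/- **Setting.** Let $\mathbf x=(x_s)_{s\in S}$ and $\mathbf y=(y_s)_{s\in S'}$ be two disjoint families of indeterminates. A matrix $[A_{n,k}]_{n,k\ge 0}$ with entries in $\mathbb R[\mathbf x,\mathbf y]$ is $(\mathbf x,\mathbf y)$-totally positive if all its (finite) minors are polynomials with nonnegative coefficients in $\mathbf x,\mathbf y$. The Toeplitz matrix of a sequence $(c_k)_{k\ge0}$ is $[c_{i-j}]_{i,j\ge0}$, with $c_m=0$ for $m<0$. Fix integers $t,\ell\ge 0$, and let $a_n^{(i)}\in\mathbb R[\mathbf x]$ $(0\le i\le \ell,\ n\ge0)$ and $b_n\in\mathbb R[\mathbf y]$ $(n\ge0)$ be polynomials with nonnegative coefficients. Consider lattice paths in $\mathbb N^2$ with steps $(0,1)$ and $(1,t+i)$ for $0\le i\le\ell$. A step $(0,1)$ from height $n-1$ to height $n$ has weight $b_n$, a step $(1,t+i)$ from height $n-t-i$ to height $n$ has weight $a_n^{(i)}$, and the weight of a path is the product of the weights of its steps. Let $M=[M_{n,k}]_{n,k\ge0}$, where $M_{n,k}\in\mathbb R[\mathbf x,\mathbf y]$ is the sum of the weights of all such paths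 from $(0,0)$ to $(k,n)$. **Theorem 1.4.** Suppose $\ell=1$. Then (i) the matrix $M$ is $(\mathbf x,\mathbf y)$-totally positive; (ii) if $t\ge1$, then for every $n\ge0$ the Toeplitz matrix of the row sequence $(M_{n,k})_{k\ge0}$ is $(\mathbf x,\mathbf y)$-totally positive. -/

import Mathlib

open MvPolynomial

/-- The steps of the lattice paths for the parameter `ℓ`: the vertical step `(0, 1)`, and the
steps `(1, t + i)` for `0 ≤ i ≤ ℓ`. -/
inductive LatticeStep (ℓ : ℕ) : Type
  | up : LatticeStep ℓ
  | diag (i : Fin (ℓ + 1)) : LatticeStep ℓ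

namespace LatticeStep

/-- The displacement vector of a step. -/
def vec {ℓ : ℕ} (t : ℕ) : LatticeStep ℓ → ℕ × ℕ
  | up => (0, 1)
  | diag i => (1, t + (i : ℕ))

instance finite (ℓ : ℕ) : Finite (LatticeStep ℓ) :=
  Finite.of_surjective
    (fun o : Option (Fin (ℓ + 1)) => match o with
      | none => (up : LatticeStep ℓ)
      | some i => diag i)
    (fun s => match s with
      | up => ⟨none, rfl⟩
      | diag i => ⟨some i, rfl⟩)

end LatticeStep

/-- The lattice paths in `ℕ²` from `(0, 0)` to `(k, n)` with steps `(0, 1)` and `(1, t + i)`,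
`0 ≤ i ≤ ℓ`; a path is given by the list of its steps, in the order in which they are taken. -/
def latticePaths (t ℓ n k : ℕ) : Set (List (LatticeStep ℓ)) :=
  {p | (p.map (LatticeStep.vec t)).sum = (k, n)}

theorem length_le_of_latticePath (t ℓ : ℕ) (p : List (LatticeStep ℓ)) :
    p.length ≤ (p.map (LatticeStep.vec t)).sum.1 + (p.map (LatticeStep.vec t)).sum.2 := by
  induction p with
  | nil => simp
  | cons s p ih =>
    cases s <;> simp [LatticeStep.vec] <;> omega

theorem latticePaths_finite (t ℓ n k : ℕ) : (latticePaths t ℓ n k).Finite := by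
  refine (List.finite_length_le (LatticeStep ℓ) (k + n)).subset ?_
  intro p hp
  have h := length_le_of_latticePath t ℓ p
  rw [show (p.map (LatticeStep.vec t)).sum = (k, n) from hp] at h
  exact h

/-- The weight of the path with the given list of steps when it starts at height `h`.
A step `(0, 1)` that ends at height `m` (so from height `m - 1`) has weight `b m`; a step
`(1, t + i)` that ends at height `m` (so from height `m - t - i`) has weight `a i m`. -/
def pathWeight {R : Type*} [CommSemiring R] {ℓ : ℕ} (t : ℕ) (a : ℕ → ℕ → R) (b : ℕ → R) :
    ℕ → List (LatticeStep ℓ) → R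
  | _, [] => 1
  | h, LatticeStep.up :: p => b (h + 1) * pathWeight t a b (h + 1) p
  | h, LatticeStep.diag i :: p => a i (h + t + i) * pathWeight t a b (h + t + i) p

/-- The matrix whose entry in row `n` and column `k` is the sum of the weights of all the lattice
paths from `(0, 0)` to `(k, n)`. -/
noncomputable def pathMatrix {R : Type*} [CommSemiring R] (t ℓ : ℕ) (a : ℕ → ℕ → R)
    (b : ℕ → R) : Matrix ℕ ℕ R :=
  Matrix.of fun n k => ∑ p ∈ (latticePaths_finite t ℓ n k).toFinset, pathWeight t a b 0 p

/-- The matrix `M` for weights `a i n` (the polynomial `a_n^{(i)}`) in the indeterminates `x_s`,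
`s : σ`, and `b n` in the indeterminates `y_s`, `s : τ`. The entries are polynomials in all these
indeterminates together. -/
noncomputable def latticeMatrix {σ τ : Type*} (t ℓ : ℕ) (a : ℕ → ℕ → MvPolynomial σ ℝ)
    (b : ℕ → MvPolynomial τ ℝ) : Matrix ℕ ℕ (MvPolynomial (σ ⊕ τ) ℝ) :=
  pathMatrix t ℓ (fun i n => rename Sum.inl (a i n)) (fun n => rename Sum.inr (b n))

/-- All the coefficients of the polynomial are nonnegative. -/
def HasNonnegCoeffs {σ : Type*} (p : MvPolynomial σ ℝ) : Prop :=
  ∀ m : σ →₀ ℕ, 0 ≤ coeff m p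

/-- Coefficientwise total positivity: all minors of the matrix are polynomials with nonnegative
coefficients. -/
def IsCoeffTotallyPositive {σ : Type*} (A : Matrix ℕ ℕ (MvPolynomial σ ℝ)) : Prop :=
  ∀ (r : ℕ) (f g : Fin r → ℕ), StrictMono f → StrictMono g →
    HasNonnegCoeffs (A.submatrix f g).det

/-- The Toeplitz matrix `[c_{i-j}]` of a sequence, where `c_m = 0` for `m < 0`. -/
def toeplitzMatrix {R : Type*} [Zero R] (c : ℕ → R) : Matrix ℕ ℕ R :=
  Matrix.of fun i j => if j ≤ i then c (i - j) else 0

/-! Splitting a path at its last step gives `M = B G (1 ⊕ M)`. Here `B` is the inverse of a lower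
bidiagonal matrix and encodes runs of vertical steps. `G` holds the diagonal weights; since `ℓ = 1`,
each of its rows has at most two entries, in adjacent columns, and these form a staircase. The
corner `1` accounts for the empty path. All three operations preserve nonnegativity of minors, and
columns below `K + 1` of `1 ⊕ M` involve only columns below `K` of `M`, so induction on the number
of columns proves total positivity (`det_submatrix_mem_of_recurrence`).

For the Toeplitz matrix of row `n`, the rows of `M` after `n` are replaced by successive right
shifts of row `n`. The new matrix solves an equation of the same form, and its rows from `n` on are
the transposed Toeplitz matrix.

Polynomials with nonnegative coefficients enter only as a subsemiring `P`. -/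

/-- The block sum `1 ⊕ A`: the matrix `A` bordered by a row and a column of zeros, with a `1` in
the corner. -/
def borderOne {R : Type*} [Zero R] [One R] (A : Matrix ℕ ℕ R) : Matrix ℕ ℕ R
  | 0, 0 => 1
  | 0, _ + 1 => 0
  | _ + 1, 0 => 0
  | p + 1, k + 1 => A p k

/-- All minors of `A` that use only the first `K` columns belong to the subsemiring `P`. -/
def MinorsMemBelow {R : Type*} [CommRing R] (P : Subsemiring R) (K : ℕ) (A : Matrix ℕ ℕ R) :
    Prop :=
  ∀ (r : ℕ) (f g : Fin r → ℕ), StrictMono f → StrictMono g → (∀ i, g i < K) →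
    (A.submatrix f g).det ∈ P

/-! ### Operations that keep minors in a subsemiring -/

section TotalPositivity

variable {R : Type*} [CommRing R] {P : Subsemiring R} {K : ℕ}

theorem MinorsMemBelow.det_mem_of_monotone {A : Matrix ℕ ℕ R} (hA : MinorsMemBelow P K A)
    {r : ℕ} {f g : Fin r → ℕ} (hf : Monotone f) (hg : StrictMono g) (hK : ∀ i, g i < K) :
    (A.submatrix f g).det ∈ P := by
  by_cases h : Function.Injective f
  · exact hA r f g (hf.strictMono_of_injective h) hg hK
  · obtain ⟨i, j, hij, hne⟩ := Function.not_injective_iff.mp h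
    rw [Matrix.det_zero_of_row_eq hne (by ext c; simp [hij])]
    exact P.zero_mem

/-- A minor that meets exactly one of row `0` and column `0` vanishes; otherwise it reduces to a
minor of `A`, after expansion along row `0` if it meets both. -/
theorem MinorsMemBelow.borderOne {A : Matrix ℕ ℕ R} (hA : MinorsMemBelow P K A) :
    MinorsMemBelow P (K + 1) (borderOne A) := by
  intro r f g hf hg hK
  have shift : ∀ (r : ℕ) (f g : Fin r → ℕ), StrictMono f → StrictMono g →
      (∀ i, g i < K + 1) → (∀ i, 0 < f i) → (∀ i, 0 < g i) →
      ((_root_.borderOne A).submatrix f g).det ∈ P := by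
    intro r f g hf hg hK hf0 hg0
    have e : (_root_.borderOne A).submatrix f g =
        A.submatrix (fun i => f i - 1) (fun i => g i - 1) := by
      ext i j
      obtain ⟨p, hp⟩ := Nat.exists_eq_succ_of_ne_zero (hf0 i).ne'
      obtain ⟨q, hq⟩ := Nat.exists_eq_succ_of_ne_zero (hg0 j).ne'
      simp [hp, hq, _root_.borderOne]
    rw [e]
    refine hA r _ _ (fun i j h => ?_) (fun i j h => ?_) (fun i => ?_)
    · have := hf h; have := hf0 i; omega
    · have := hg h; have := hg0 i; omega
    · have := hK i; have := hg0 i; omega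
  cases r with
  | zero => rw [Matrix.det_fin_zero]; exact P.one_mem
  | succ r =>
    have hfpos : ∀ i : Fin r, 0 < f i.succ := fun i => (Nat.zero_le _).trans_lt (hf i.succ_pos)
    have hgpos : ∀ i : Fin r, 0 < g i.succ := fun i => (Nat.zero_le _).trans_lt (hg i.succ_pos)
    rcases Nat.eq_zero_or_pos (f 0) with hf0 | hf0 <;> rcases Nat.eq_zero_or_pos (g 0) with hg0 | hg0
    · have hrow : ∀ j : Fin r, _root_.borderOne A (f 0) (g j.succ) = 0 := fun j => by
        obtain ⟨q, hq⟩ := Nat.exists_eq_succ_of_ne_zero (hgpos j).ne'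
        rw [hf0, hq]; rfl
      rw [Matrix.det_succ_row_zero, Fin.sum_univ_succ]
      simp only [Matrix.submatrix_apply, hrow, Fin.val_zero, pow_zero, one_mul, mul_zero,
        zero_mul, Finset.sum_const_zero, add_zero]
      rw [hf0, hg0, show _root_.borderOne A 0 0 = 1 from rfl, one_mul, Matrix.submatrix_submatrix]
      exact shift r _ _ (hf.comp (Fin.strictMono_succ)) (hg.comp (Fin.strictMono_succAbove 0))
        (fun i => hK _) hfpos (fun i => by simpa using hgpos i)
    · rw [Matrix.det_eq_zero_of_row_eq_zero 0]
      · exact P.zero_mem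
      · intro j
        obtain ⟨q, hq⟩ := Nat.exists_eq_succ_of_ne_zero
          (hg0.trans_le (hg.monotone (Fin.zero_le j))).ne'
        rw [Matrix.submatrix_apply, hf0, hq]; rfl
    · rw [Matrix.det_eq_zero_of_column_eq_zero 0]
      · exact P.zero_mem
      · intro j
        obtain ⟨q, hq⟩ := Nat.exists_eq_succ_of_ne_zero
          (hf0.trans_le (hf.monotone (Fin.zero_le j))).ne'
        rw [Matrix.submatrix_apply, hg0, hq]; rfl
    · exact shift _ f g hf hg hK (fun i => hf0.trans_le (hf.monotone (Fin.zero_le i)))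
        (fun i => hg0.trans_le (hg.monotone (Fin.zero_le i)))

/-- Left multiplication by a matrix with at most two nonzero entries in each row, which are
arranged like a staircase. -/
theorem MinorsMemBelow.staircase {E : Matrix ℕ ℕ R} (hE : MinorsMemBelow P K E)
    {α β : ℕ → R} (hα : ∀ p, α p ∈ P) (hβ : ∀ p, β p ∈ P) {u l : ℕ → ℕ}
    (hlu : ∀ p, l p ≤ u p) (hul : ∀ p q, p < q → u p ≤ l q) :
    MinorsMemBelow P K (Matrix.of fun p k => α p * E (u p) k + β p * E (l p) k) := by
  classical
  intro r f g hf hg hK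
  -- Multilinearity in the rows: `s` records the rows in which the `α` term is chosen.
  have key : ((Matrix.of fun p k => α p * E (u p) k + β p * E (l p) k).submatrix f g).det =
      ∑ s : Finset (Fin r), (∏ i, if i ∈ s then α (f i) else β (f i)) *
        (E.submatrix (fun i => if i ∈ s then u (f i) else l (f i)) g).det := by
    have h := (Matrix.detRowAlternating (R := R) (n := Fin r)).toMultilinearMap.map_add_univ
      (fun i j => α (f i) * E (u (f i)) (g j)) (fun i j => β (f i) * E (l (f i)) (g j))
    refine Eq.trans ?_ (h.trans (Finset.sum_congr rfl fun s _ => ?_))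
    · rfl
    · have h2 := (Matrix.detRowAlternating (R := R) (n := Fin r)).toMultilinearMap.map_smul_univ
        (fun i => if i ∈ s then α (f i) else β (f i))
        (fun i j => E (if i ∈ s then u (f i) else l (f i)) (g j))
      refine Eq.trans ?_ h2
      congr 1
      ext i j
      by_cases hi : i ∈ s <;> simp [hi]
  rw [key]
  refine P.sum_mem fun s _ => P.mul_mem (P.prod_mem fun i _ => ?_) ?_
  · split_ifs
    exacts [hα _, hβ _]
  -- By the staircase condition the chosen rows increase weakly; a repetition makes the minor zero.
  · refine hE.det_mem_of_monotone (fun i j hij => ?_) hg hK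
    rcases hij.eq_or_lt with rfl | hij
    · exact le_rfl
    · have h1 := hul _ _ (hf hij)
      have h2 := hlu (f i)
      have h3 := hlu (f j)
      split_ifs <;> omega

/-- Adding a multiple of a row to the next row. -/
theorem MinorsMemBelow.updateRow {V : Matrix ℕ ℕ R} (hV : MinorsMemBelow P K V) {c : R}
    (hc : c ∈ P) (N : ℕ) :
    MinorsMemBelow P K (V.updateRow (N + 1) (V (N + 1) + c • V N)) := by
  intro r f g hf hg hK
  by_cases h : ∃ i, f i = N + 1
  · obtain ⟨i, hi⟩ := h
    have e : (V.updateRow (N + 1) (V (N + 1) + c • V N)).submatrix f g =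
        (V.submatrix f g).updateRow i
          ((fun j => V (N + 1) (g j)) + c • fun j => V N (g j)) := by
      ext i' j
      by_cases h' : i' = i
      · subst h'; simp [hi]
      · have : f i' ≠ N + 1 := fun h => h' (hf.injective (h.trans hi.symm))
        simp [h', this]
    have e1 : (V.submatrix f g).updateRow i (fun j => V (N + 1) (g j)) = V.submatrix f g := by
      ext i' j
      by_cases h' : i' = i
      · subst h'; simp [hi]
      · simp [h']
    have e2 : (V.submatrix f g).updateRow i (fun j => V N (g j)) =
        V.submatrix (Function.update f i N) g := by
      ext i' j
      by_cases h' : i' = i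
      · subst h'; simp
      · simp [h']
    rw [e, Matrix.det_updateRow_add, Matrix.det_updateRow_smul, e1, e2]
    refine P.add_mem (hV r f g hf hg hK) (P.mul_mem hc ?_)
    -- Lowering the index `N + 1` to `N` keeps the row indices weakly increasing.
    refine hV.det_mem_of_monotone (fun x y hxy => ?_) hg hK
    rcases hxy.eq_or_lt with rfl | hxy
    · exact le_rfl
    have hlt := hf hxy
    by_cases hx : x = i
    · subst hx
      simp only [Function.update_self, Function.update_of_ne hxy.ne']
      omega
    · by_cases hy : y = i
      · subst hy
        simp only [Function.update_self, Function.update_of_ne hxy.ne]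
        omega
      · simp only [Function.update_of_ne hx, Function.update_of_ne hy]
        exact hlt.le
  · have e : (V.updateRow (N + 1) (V (N + 1) + c • V N)).submatrix f g = V.submatrix f g := by
      ext i j
      have : f i ≠ N + 1 := fun h' => h ⟨i, h'⟩
      simp [this]
    rw [e]
    exact hV r f g hf hg hK

/-- Left multiplication by the inverse of a lower bidiagonal matrix with unit diagonal. -/
theorem MinorsMemBelow.of_row_recurrence {A V : Matrix ℕ ℕ R} (hV : MinorsMemBelow P K V)
    {b : ℕ → R} (hb : ∀ n, b n ∈ P) (h0 : ∀ k, A 0 k = V 0 k)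
    (hs : ∀ p k, A (p + 1) k = V (p + 1) k + b (p + 1) * A p k) : MinorsMemBelow P K A := by
  -- Turn `V` into `A` one row at a time, from the top; a given minor sees only finitely many rows.
  have h : ∀ N, MinorsMemBelow P K (Matrix.of fun p k => if p ≤ N then A p k else V p k) := by
    intro N
    induction N with
    | zero =>
      convert hV using 1
      ext p k
      rcases p with _ | p <;> simp [h0]
    | succ N ih =>
      convert ih.updateRow (hb (N + 1)) N using 1
      ext p k
      by_cases hp : p = N + 1
      · subst hp; simp [hs]
      · have : p ≤ N + 1 ↔ p ≤ N := by omega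
        simp [hp, this]
  intro r f g hf hg hK
  convert h (∑ i, f i) r f g hf hg hK using 2
  ext i j
  have : f i ≤ ∑ i, f i := Finset.single_le_sum (f := f) (fun _ _ => Nat.zero_le _)
    (Finset.mem_univ i)
  simp [this]

/-- A matrix `A` that solves `A = B G (1 ⊕ A)`, where `B` is the inverse of a lower bidiagonal
matrix and `G` is a staircase matrix, is totally positive. -/
theorem det_submatrix_mem_of_recurrence {A : Matrix ℕ ℕ R} {α β b : ℕ → R}
    (hα : ∀ p, α p ∈ P) (hβ : ∀ p, β p ∈ P) (hb : ∀ p, b p ∈ P) {u l : ℕ → ℕ}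
    (hlu : ∀ p, l p ≤ u p) (hul : ∀ p q, p < q → u p ≤ l q)
    (h0 : ∀ k, A 0 k = α 0 * borderOne A (u 0) k + β 0 * borderOne A (l 0) k)
    (hs : ∀ p k, A (p + 1) k = α (p + 1) * borderOne A (u (p + 1)) k +
      β (p + 1) * borderOne A (l (p + 1)) k + b (p + 1) * A p k)
    (r : ℕ) (f g : Fin r → ℕ) (hf : StrictMono f) (hg : StrictMono g) :
    (A.submatrix f g).det ∈ P := by
  have h : ∀ K, MinorsMemBelow P K A := by
    intro K
    induction K with
    | zero =>
      intro r f g _ _ hK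
      cases r with
      | zero => rw [Matrix.det_fin_zero]; exact P.one_mem
      | succ r => exact absurd (hK 0) (Nat.not_lt_zero _)
    | succ K ih => exact (ih.borderOne.staircase hα hβ hlu hul).of_row_recurrence hb h0 hs
  exact h (∑ i, g i + 1) r f g hf hg fun i => Nat.lt_succ_of_le
    (Finset.single_le_sum (f := g) (fun _ _ => Nat.zero_le _) (Finset.mem_univ i))

end TotalPositivity

/-! ### Decomposition of paths by the last step -/

section Paths

variable {R : Type*} [CommSemiring R]

theorem pathWeight_append {ℓ : ℕ} (t : ℕ) (a : ℕ → ℕ → R) (b : ℕ → R)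
    (p q : List (LatticeStep ℓ)) (h : ℕ) :
    pathWeight t a b h (p ++ q) =
      pathWeight t a b h p * pathWeight t a b (h + (p.map (LatticeStep.vec t)).sum.2) q := by
  induction p generalizing h with
  | nil => simp [pathWeight]
  | cons s p ih =>
    cases s <;> simp [pathWeight, ih, LatticeStep.vec, mul_assoc, add_assoc]

/-- The total weight of the paths from `(0, 0)` to `(k, n)` whose last step is `s`. -/
noncomputable def lastStepSum {ℓ : ℕ} (t : ℕ) (a : ℕ → ℕ → R) (b : ℕ → R) (n k : ℕ)
    (s : LatticeStep ℓ) : R := by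
  classical
  exact ∑ p ∈ (latticePaths_finite t ℓ n k).toFinset with p.getLast? = some s,
    pathWeight t a b 0 p

theorem lastStepSum_eq {ℓ : ℕ} (t : ℕ) (a : ℕ → ℕ → R) (b : ℕ → R) (n k m j : ℕ)
    (s : LatticeStep ℓ) (h : (j, m) + s.vec t = (k, n)) :
    lastStepSum t a b n k s = pathMatrix t ℓ a b m j * pathWeight t a b m [s] := by
  classical
  rw [lastStepSum, pathMatrix, Matrix.of_apply, Finset.sum_mul]
  symm
  refine Finset.sum_bij (fun p _ => p ++ [s]) ?_ ?_ ?_ ?_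
  · intro p hp
    have hp : (p.map (LatticeStep.vec t)).sum = (j, m) := by simpa [latticePaths] using hp
    simp [latticePaths, hp, h]
  · intro p _ q _ hpq
    exact List.append_cancel_right hpq
  · intro p hp
    obtain ⟨hp, hl⟩ := Finset.mem_filter.mp hp
    obtain ⟨q, rfl⟩ := List.getLast?_eq_some_iff.mp hl
    refine ⟨q, ?_, rfl⟩
    have hp : (q.map (LatticeStep.vec t)).sum + s.vec t = (k, n) := by
      simpa [latticePaths] using hp
    simpa [latticePaths] using add_right_cancel (hp.trans h.symm)
  · intro p hp
    have hp : (p.map (LatticeStep.vec t)).sum = (j, m) := by simpa [latticePaths] using hp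
    simp [pathWeight_append, hp]

theorem lastStepSum_eq_zero {ℓ : ℕ} (t : ℕ) (a : ℕ → ℕ → R) (b : ℕ → R) (n k : ℕ)
    (s : LatticeStep ℓ) (h : ∀ v, v + s.vec t ≠ (k, n)) :
    lastStepSum t a b n k s = 0 := by
  classical
  rw [lastStepSum, Finset.filter_false_of_mem, Finset.sum_empty]
  intro p hp hl
  obtain ⟨q, rfl⟩ := List.getLast?_eq_some_iff.mp hl
  exact h (q.map (LatticeStep.vec t)).sum (by simpa [latticePaths] using hp)

theorem pathMatrix_eq_sum_lastStepSum (t : ℕ) (a : ℕ → ℕ → R) (b : ℕ → R) (n k : ℕ) :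
    pathMatrix t 1 a b n k = (if n = 0 ∧ k = 0 then 1 else 0) +
      lastStepSum t a b n k (LatticeStep.up : LatticeStep 1) +
      lastStepSum t a b n k (LatticeStep.diag (0 : Fin 2)) +
      lastStepSum t a b n k (LatticeStep.diag (1 : Fin 2)) := by
  classical
  have hnil : (if n = 0 ∧ k = 0 then (1 : R) else 0) =
      ∑ p ∈ (latticePaths_finite t 1 n k).toFinset with p.getLast? = none,
        pathWeight t a b 0 p := by
    split_ifs with h
    · obtain ⟨rfl, rfl⟩ := h
      rw [Finset.sum_eq_single []]
      · rfl
      · intro p hp hne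
        exact absurd (List.getLast?_eq_none_iff.mp (Finset.mem_filter.mp hp).2) hne
      · intro hp
        exact absurd (by simp [latticePaths, ← Prod.zero_eq_mk]) hp
    · rw [Finset.filter_false_of_mem, Finset.sum_empty]
      intro p hp hl
      rw [List.getLast?_eq_none_iff.mp hl] at hp
      have : (0 : ℕ × ℕ) = (k, n) := by simpa [latticePaths] using hp
      exact h ⟨(congrArg Prod.snd this).symm, (congrArg Prod.fst this).symm⟩
  rw [hnil, pathMatrix, Matrix.of_apply]
  simp only [lastStepSum, Finset.sum_filter]
  rw [← Finset.sum_add_distrib, ← Finset.sum_add_distrib, ← Finset.sum_add_distrib]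
  refine Finset.sum_congr rfl fun p _ => ?_
  rcases p.getLast? with _ | _ | i
  · simp
  · simp
  · fin_cases i <;> simp

theorem lastStepSum_up_succ (t : ℕ) (a : ℕ → ℕ → R) (b : ℕ → R) (n k : ℕ) :
    lastStepSum t a b (n + 1) k (LatticeStep.up : LatticeStep 1) =
      b (n + 1) * pathMatrix t 1 a b n k := by
  rw [lastStepSum_eq t a b (n + 1) k n k _ rfl]
  simp [pathWeight, mul_comm]

theorem lastStepSum_up_zero (t : ℕ) (a : ℕ → ℕ → R) (b : ℕ → R) (k : ℕ) :
    lastStepSum t a b 0 k (LatticeStep.up : LatticeStep 1) = 0 :=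
  lastStepSum_eq_zero _ _ _ _ _ _ fun v hv => by
    simpa [LatticeStep.vec] using congrArg Prod.snd hv

end Paths

/-! ### The matrix equation and its shifted continuation -/

section Recurrence

variable {R : Type*} [CommRing R]

theorem lastStepSum_diag_zero (t : ℕ) (a : ℕ → ℕ → R) (b : ℕ → R) (n k : ℕ) :
    lastStepSum t a b n k (LatticeStep.diag (0 : Fin 2)) =
      (if t ≤ n then a 0 n else 0) * borderOne (pathMatrix t 1 a b) (n + 1 - t) k := by
  by_cases h : t ≤ n ∧ 0 < k
  · obtain ⟨h, hk⟩ := h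
    obtain ⟨k, rfl⟩ := Nat.exists_eq_succ_of_ne_zero hk.ne'
    obtain ⟨m, rfl⟩ := Nat.exists_eq_add_of_le' h
    rw [lastStepSum_eq t a b (m + t) (k + 1) m k _ (by simp [LatticeStep.vec]),
      show m + t + 1 - t = m + 1 by omega]
    simp [pathWeight, borderOne, mul_comm]
  · rw [lastStepSum_eq_zero]
    · by_cases h' : t ≤ n
      · obtain rfl : k = 0 := by omega
        rw [show n + 1 - t = n - t + 1 by omega]
        simp [borderOne]
      · simp [h']
    · rintro ⟨x, y⟩ hv
      simp [LatticeStep.vec] at hv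
      omega

/-- The empty path is absorbed here: for `n = 0` truncated subtraction selects row `0` of `1 ⊕ M`,
which is `(1, 0, 0, …)`, with coefficient `1`. For `0 < n ≤ t` the coefficient `0` cancels that row.
-/
theorem lastStepSum_diag_one (t : ℕ) (a : ℕ → ℕ → R) (b : ℕ → R) (n k : ℕ) :
    lastStepSum t a b n k (LatticeStep.diag (1 : Fin 2)) + (if n = 0 ∧ k = 0 then 1 else 0) =
      (if t < n then a 1 n else if n = 0 then 1 else 0) *
        borderOne (pathMatrix t 1 a b) (n - t) k := by
  by_cases h : t < n ∧ 0 < k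
  · obtain ⟨h, hk⟩ := h
    obtain ⟨k, rfl⟩ := Nat.exists_eq_succ_of_ne_zero hk.ne'
    obtain ⟨m, rfl⟩ := Nat.exists_eq_add_of_lt h
    rw [lastStepSum_eq t a b (t + m + 1) (k + 1) m k _ (by simp [LatticeStep.vec]; omega),
      show t + m + 1 - t = m + 1 by omega, if_pos h]
    simp [pathWeight, borderOne, mul_comm, show m + t + 1 = t + m + 1 by omega]
  · rw [lastStepSum_eq_zero]
    · by_cases h' : t < n
      · obtain rfl : k = 0 := by omega
        rw [show n - t = n - t - 1 + 1 by omega]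
        simp [borderOne, show n ≠ 0 by omega]
      · rcases n with _ | n
        · rcases k with _ | k <;> simp [borderOne]
        · simp [h']
    · rintro ⟨x, y⟩ hv
      simp [LatticeStep.vec] at hv
      omega

theorem pathMatrix_zero_row (t : ℕ) (a : ℕ → ℕ → R) (b : ℕ → R) (k : ℕ) :
    pathMatrix t 1 a b 0 k =
      (if t ≤ 0 then a 0 0 else 0) * borderOne (pathMatrix t 1 a b) (0 + 1 - t) k +
      (if t < 0 then a 1 0 else if 0 = 0 then 1 else 0) *
        borderOne (pathMatrix t 1 a b) (0 - t) k := by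
  rw [← lastStepSum_diag_zero, ← lastStepSum_diag_one, pathMatrix_eq_sum_lastStepSum,
    lastStepSum_up_zero]
  ring

theorem pathMatrix_succ_row (t : ℕ) (a : ℕ → ℕ → R) (b : ℕ → R) (n k : ℕ) :
    pathMatrix t 1 a b (n + 1) k =
      (if t ≤ n + 1 then a 0 (n + 1) else 0) *
        borderOne (pathMatrix t 1 a b) (n + 1 + 1 - t) k +
      (if t < n + 1 then a 1 (n + 1) else if n + 1 = 0 then 1 else 0) *
        borderOne (pathMatrix t 1 a b) (n + 1 - t) k +
      b (n + 1) * pathMatrix t 1 a b n k := by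
  rw [← lastStepSum_diag_zero, ← lastStepSum_diag_one, pathMatrix_eq_sum_lastStepSum,
    lastStepSum_up_succ]
  ring

/-- The matrix whose rows `0, …, n` are those of `A`, and in which each further row is the
previous one shifted to the right. -/
def continueByShift (n : ℕ) (A : Matrix ℕ ℕ R) : Matrix ℕ ℕ R :=
  Matrix.of fun p k => if p ≤ n then A p k else if p - n ≤ k then A n (k - (p - n)) else 0

theorem borderOne_continueByShift {n q : ℕ} (A : Matrix ℕ ℕ R) (k : ℕ) (hq : q ≤ n + 1) :
    borderOne (continueByShift n A) q k = borderOne A q k := by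
  rcases q with _ | q <;> rcases k with _ | k
  · rfl
  · rfl
  · rfl
  · simp [borderOne, continueByShift, show q ≤ n by omega]

/-- Bordering moves each row down and right by one, which is exactly the shift rule beyond row `n`.
-/
theorem continueByShift_of_lt {n p : ℕ} (A : Matrix ℕ ℕ R) (k : ℕ) (hp : n < p) :
    continueByShift n A p k = borderOne (continueByShift n A) p k := by
  obtain ⟨q, rfl⟩ := Nat.exists_eq_succ_of_ne_zero (Nat.ne_zero_of_lt hp)
  rcases k with _ | k
  · simp [borderOne, continueByShift, show ¬ q + 1 ≤ n by omega]
  · rcases (Nat.le_of_lt_succ hp).eq_or_lt with rfl | h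
    · simp [borderOne, continueByShift]
    · simp only [borderOne, continueByShift, Matrix.of_apply, show ¬ q.succ ≤ n by omega,
        show ¬ q ≤ n by omega, if_false]
      rw [show k + 1 - (q.succ - n) = k - (q - n) by omega]
      exact if_congr (by omega) rfl rfl

variable {P : Subsemiring R} {t : ℕ} {a : ℕ → ℕ → R} {b : ℕ → R}

theorem det_pathMatrix_submatrix_mem (ha : ∀ i n, i ≤ 1 → a i n ∈ P) (hb : ∀ n, b n ∈ P)
    (r : ℕ) (f g : Fin r → ℕ) (hf : StrictMono f) (hg : StrictMono g) :
    ((pathMatrix t 1 a b).submatrix f g).det ∈ P := by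
  refine det_submatrix_mem_of_recurrence
    (α := fun n => if t ≤ n then a 0 n else 0)
    (β := fun n => if t < n then a 1 n else if n = 0 then 1 else 0)
    (u := fun n => n + 1 - t) (l := fun n => n - t) ?_ ?_ hb ?_ ?_
    (pathMatrix_zero_row t a b) (pathMatrix_succ_row t a b) r f g hf hg
  · intro p
    split_ifs
    exacts [ha 0 p (by simp), P.zero_mem]
  · intro p
    split_ifs
    exacts [ha 1 p le_rfl, P.one_mem, P.zero_mem]
  · intro p; omega
  · intro p q h; omega

/-- Up to row `n` the coefficients are those of `M`; beyond it the recurrence just copies row `p` of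
the bordered matrix, so `u p = l p = p` with weights `0` and `1`, and the staircase persists across
the junction. -/
theorem det_continueByShift_submatrix_mem (ha : ∀ i n, i ≤ 1 → a i n ∈ P) (hb : ∀ n, b n ∈ P)
    (n r : ℕ) (f g : Fin r → ℕ) (hf : StrictMono f) (hg : StrictMono g) :
    ((continueByShift n (pathMatrix t 1 a b)).submatrix f g).det ∈ P := by
  refine det_submatrix_mem_of_recurrence
    (α := fun p => if p ≤ n then if t ≤ p then a 0 p else 0 else 0)
    (β := fun p => if p ≤ n then if t < p then a 1 p else if p = 0 then 1 else 0 else 1)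
    (b := fun p => if p ≤ n then b p else 0)
    (u := fun p => if p ≤ n then p + 1 - t else p)
    (l := fun p => if p ≤ n then p - t else p) ?_ ?_ ?_ ?_ ?_ ?_ ?_ r f g hf hg
  · intro p
    split_ifs
    exacts [ha 0 p (by simp), P.zero_mem, P.zero_mem]
  · intro p
    split_ifs
    exacts [ha 1 p le_rfl, P.one_mem, P.zero_mem, P.one_mem]
  · intro p
    split_ifs
    exacts [hb p, P.zero_mem]
  · intro p; split_ifs <;> omega
  · intro p q h; split_ifs <;> omega
  · intro k
    simp only [Nat.zero_le, if_true]
    rw [borderOne_continueByShift _ _ (by omega), borderOne_continueByShift _ _ (by omega)]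
    exact pathMatrix_zero_row t a b k
  · intro p k
    by_cases hp : p + 1 ≤ n
    · simp only [hp, if_true]
      rw [borderOne_continueByShift _ _ (by omega), borderOne_continueByShift _ _ (by omega)]
      simp only [continueByShift, Matrix.of_apply, hp, show p ≤ n by omega, if_true]
      exact pathMatrix_succ_row t a b p k
    · simp only [hp, if_false, zero_mul, one_mul, zero_add, add_zero]
      exact continueByShift_of_lt _ _ (not_le.mp hp)

theorem toeplitzMatrix_eq_transpose (A : Matrix ℕ ℕ R) (n : ℕ) :
    toeplitzMatrix (fun k => A n k) =
      ((continueByShift n A).submatrix (n + ·) id).transpose := by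
  ext i j
  rcases j with _ | j
  · simp [toeplitzMatrix, continueByShift]
  · simp [toeplitzMatrix, continueByShift, show n + (j + 1) ≤ i + n ↔ j < i by omega]

theorem det_toeplitzMatrix_row_submatrix_mem (ha : ∀ i n, i ≤ 1 → a i n ∈ P)
    (hb : ∀ n, b n ∈ P) (n r : ℕ) (f g : Fin r → ℕ) (hf : StrictMono f) (hg : StrictMono g) :
    ((toeplitzMatrix fun k => pathMatrix t 1 a b n k).submatrix f g).det ∈ P := by
  rw [toeplitzMatrix_eq_transpose, ← Matrix.transpose_submatrix, Matrix.det_transpose,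
    Matrix.submatrix_submatrix]
  exact det_continueByShift_submatrix_mem ha hb n r _ _
    (fun i j h => Nat.add_lt_add_left (hg h) n) hf

end Recurrence

/-- The subsemiring of the polynomials with nonnegative coefficients. -/
def nonnegCoeffs (σ : Type*) : Subsemiring (MvPolynomial σ ℝ) where
  carrier := {p | HasNonnegCoeffs p}
  zero_mem' m := by simp
  one_mem' m := by
    classical
    rw [coeff_one]
    split_ifs <;> simp
  add_mem' hp hq m := by
    rw [coeff_add]
    exact add_nonneg (hp m) (hq m)
  mul_mem' hp hq m := by
    classical
    rw [coeff_mul]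
    exact Finset.sum_nonneg fun x _ => mul_nonneg (hp x.1) (hq x.2)

theorem HasNonnegCoeffs.rename {σ τ : Type*} {p : MvPolynomial σ ℝ} (hp : HasNonnegCoeffs p)
    {f : σ → τ} (hf : Function.Injective f) : HasNonnegCoeffs (MvPolynomial.rename f p) := by
  intro m
  by_cases h : ∃ d, Finsupp.mapDomain f d = m
  · obtain ⟨d, rfl⟩ := h
    rw [coeff_rename_mapDomain f hf]
    exact hp d
  · rw [coeff_rename_eq_zero f p m fun d hd => absurd ⟨d, hd⟩ h]

theorem theorem1p4 {σ τ : Type*} (t : ℕ)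
    (a : ℕ → ℕ → MvPolynomial σ ℝ) (b : ℕ → MvPolynomial τ ℝ)
    (ha : ∀ i n : ℕ, i ≤ 1 → HasNonnegCoeffs (a i n))
    (hb : ∀ n : ℕ, HasNonnegCoeffs (b n)) :
    IsCoeffTotallyPositive (latticeMatrix t 1 a b) ∧
      (1 ≤ t → ∀ n : ℕ,
        IsCoeffTotallyPositive (toeplitzMatrix fun k => latticeMatrix t 1 a b n k)) := by
  have ha' : ∀ i n, i ≤ 1 → rename Sum.inl (a i n) ∈ nonnegCoeffs (σ ⊕ τ) :=
    fun i n hi => (ha i n hi).rename Sum.inl_injective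
  have hb' : ∀ n, rename Sum.inr (b n) ∈ nonnegCoeffs (σ ⊕ τ) :=
    fun n => (hb n).rename Sum.inr_injective
  exact ⟨fun r f g hf hg => det_pathMatrix_submatrix_mem (P := nonnegCoeffs (σ ⊕ τ))
      (a := fun i n => rename Sum.inl (a i n)) ha' hb' r f g hf hg,
    fun _ n r f g hf hg => det_toeplitzMatrix_row_submatrix_mem (P := nonnegCoeffs (σ ⊕ τ))
      (a := fun i n => rename Sum.inl (a i n)) ha' hb' n r f g hf hg⟩
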